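/- Let $n\ge 1$, $m\ge 1$ be integers, let $g_0=\sum_{i=1}^n\varepsilon_i\,dx_i^2$ with $\varepsilon_i\in\{1,-1\}$ be a semi-Euclidean metric on $\mathbb{R}^n$, let $\alpha=(\alpha_1,\dots,\alpha_n)\in\mathbb{R}^n$ be a nonzero vector and put $\xi(x)=\sum_{i=1}^n\alpha_i x_i$ and $\|\alpha\|^2=\sum_{i=1}^n\varepsilon_i\alpha_i^2$. Let $(F^m,g_F)$ be a (nonempty) smooth $m$-dimensional semi-Riemannian manifold. Let $\varphi,f,h,u:\mathbb{R}\to\mathbb{R}$ be smooth functions with $\varphi$ nowhere zero, $f>0$ and $u$ non-constant, and write $\varphi,f,h,u$ also for the functions $\varphi\circ\xi$, $f\circ\xi$, $h\circ\xi$, $u\circ\xi$ on $\mathbb{R}^n$ and for their compositions with the projection $\mathbb{R}^n\times F\to\mathbb{R}^n$. Consider the warped product $(\mathbb{R}^n,\varphi^{-2}g_0)\times_f F^m$, that is, the manifold $\mathbb{R}^n\times F$ with the metric $g=\varphi^{-2}g_0+f^2g_F$, and let $\lambda\in\mathbb{R}$. Assume that $(\mathbb{R}^n\times_f F^m,g,h,u,\lambda)$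 is a gradient Ricci-harmonic soliton (GRHS), that is, there is a constant $\theta\ge 0$ such that $$\mathrm{Ric}_g+\mathrm{Hess}_g\,h-\theta\,\nabla u\otimes\nabla u=\lambda g,\qquad \tau_g u-g(\nabla u,\nabla h)=0$$ on $\mathbb{R}^n\times F$, where $(\nabla u\otimes\nabla u)(X,Y)=du(X)\,du(Y)$ and $\tau_g u=\mathrm{tr}_g(\nabla du)$. If $\|\alpha\|^2=0$, then the soliton is steady and the fiber is Ricci-flat: $\lambda=0$ and $\mathrm{Ric}_{g_F}=0$; in particular, the constant $\mu$ with $\mathrm{Ric}_{g_F}=\mu g_F$ is $\mu=0$. -/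

import Mathlib

set_option maxSynthPendingDepth 3

open scoped Manifold ContDiff

noncomputable section

namespace SemiRiem

/-! ## Tensor calculus in a finite-dimensional coordinate space

`G : E → E →L[ℝ] E →L[ℝ] ℝ` is the coordinate expression of a metric: `G x v w = ∑ gᵢⱼ(x) vⁱ wʲ`. -/

section Coordinates

/-- The trace of a bilinear form `A` with respect to the nondegenerate bilinear form `b`
(in a basis: `∑ bⁱʲ Aᵢⱼ`), that is, the trace of the endomorphism `b⁻¹ ∘ A` (`V` is finite-dimensional in all uses). -/
def metricTrace {V : Type*} [AddCommGroup V] [Module ℝ V] [TopologicalSpace V]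
    [IsTopologicalAddGroup V] [ContinuousSMul ℝ V] (b A : V →L[ℝ] V →L[ℝ] ℝ) : ℝ :=
  LinearMap.trace ℝ V ((b.inverse ∘L A : V →L[ℝ] V) : V →ₗ[ℝ] V)

/-- The bilinear form `(v, w) ↦ b (A v) (A w)`. -/
def bilinComp {V W : Type*} [AddCommGroup V] [Module ℝ V] [TopologicalSpace V]
    [IsTopologicalAddGroup V] [ContinuousSMul ℝ V] [AddCommGroup W] [Module ℝ W]
    [TopologicalSpace W] [IsTopologicalAddGroup W] [ContinuousSMul ℝ W]
    (b : W →L[ℝ] W →L[ℝ] ℝ) (A : V →L[ℝ] W) : V →L[ℝ] V →L[ℝ] ℝ :=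
  (ContinuousLinearMap.precomp ℝ A) ∘L (b ∘L A)

variable {E : Type*} [NormedAddCommGroup E] [NormedSpace ℝ E]

/-- Christoffel symbols of the first kind:
`christoffelFirst G x v w z = (D_v G(w, z) + D_w G(v, z) - D_z G(v, w)) / 2` at `x`. -/
def christoffelFirst (G : E → E →L[ℝ] E →L[ℝ] ℝ) (x : E) : E →L[ℝ] E →L[ℝ] E →L[ℝ] ℝ :=
  let D : E →L[ℝ] E →L[ℝ] E →L[ℝ] ℝ := fderiv ℝ G x
  let T : E →L[ℝ] E →L[ℝ] E →L[ℝ] ℝ :=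
    ((ContinuousLinearMap.flipₗᵢ ℝ E E ℝ).toContinuousLinearEquiv :
      (E →L[ℝ] E →L[ℝ] ℝ) →L[ℝ] (E →L[ℝ] E →L[ℝ] ℝ)) ∘L D.flip
  (1 / 2 : ℝ) • (D + D.flip - T)

theorem christoffelFirst_apply (G : E → E →L[ℝ] E →L[ℝ] ℝ) (x v w z : E) :
    christoffelFirst G x v w z =
      (fderiv ℝ G x v w z + fderiv ℝ G x w v z - fderiv ℝ G x z v w) / 2 := by
  simp [christoffelFirst]
  ring

/-- Christoffel symbols of the second kind (the Levi-Civita connection is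
`∇_v Y = D_v Y + Γ(v, Y)`): `Γ x v w` is the vector with `G x (Γ x v w) z` equal to
`christoffelFirst G x v w z` for all `z`. -/
def christoffel (G : E → E →L[ℝ] E →L[ℝ] ℝ) (x : E) : E →L[ℝ] E →L[ℝ] E :=
  (ContinuousLinearMap.compL ℝ E (E →L[ℝ] ℝ) E (G x).inverse) ∘L christoffelFirst G x

theorem christoffel_apply (G : E → E →L[ℝ] E →L[ℝ] ℝ) (x v w : E) :
    christoffel G x v w = (G x).inverse (christoffelFirst G x v w) := rfl

/-- The endomorphism `v ↦ R(v, w) z`, where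
`R(v, w) z = ∇_v ∇_w z - ∇_w ∇_v z - ∇_[v, w] z` is the Riemann curvature tensor at `x`. -/
def curvatureEnd (G : E → E →L[ℝ] E →L[ℝ] ℝ) (x w z : E) : E →ₗ[ℝ] E where
  toFun v := fderiv ℝ (christoffel G) x v w z - fderiv ℝ (christoffel G) x w v z
    + christoffel G x v (christoffel G x w z) - christoffel G x w (christoffel G x v z)
  map_add' v v' := by
    simp only [map_add, add_apply]
    abel
  map_smul' c v := by
    simp only [map_smul, smul_apply, RingHom.id_apply, smul_sub, smul_add]

/-- The Ricci tensor in coordinates: `Ric(w, z) = tr (v ↦ R(v, w) z)`. -/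
def coordRicci (G : E → E →L[ℝ] E →L[ℝ] ℝ) (x w z : E) : ℝ :=
  LinearMap.trace ℝ E (curvatureEnd G x w z)

/-- The Hessian in coordinates: `Hess h (v, w) = D²h(v, w) - Dh(Γ(v, w))`. -/
def coordHessian (G : E → E →L[ℝ] E →L[ℝ] ℝ) (h : E → ℝ) (x : E) : E →L[ℝ] E →L[ℝ] ℝ :=
  fderiv ℝ (fderiv ℝ h) x - (ContinuousLinearMap.compL ℝ E E ℝ (fderiv ℝ h x)) ∘L christoffel G x

end Coordinates

/-! ## Semi-Riemannian metrics

`M` is a manifold without boundary modelled on a finite-dimensional space `E`. Tensors at `p` are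
computed in the preferred chart at `p`; by tensoriality every chart around `p` gives the same. -/

section Manifolds

variable {E : Type*} [NormedAddCommGroup E] [NormedSpace ℝ E]
  {H : Type*} [TopologicalSpace H] {I : ModelWithCorners ℝ E H}
  {M : Type*} [TopologicalSpace M] [ChartedSpace H M]
  {E' : Type*} [NormedAddCommGroup E'] [NormedSpace ℝ E']
  {H' : Type*} [TopologicalSpace H'] {J : ModelWithCorners ℝ E' H'}
  {N : Type*} [TopologicalSpace N] [ChartedSpace H' N]

variable (I M) in
/-- Fields of bilinear forms on the tangent spaces, i.e. (0,2)-tensor fields. -/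
abbrev BilinField : Type _ :=
  ∀ p : M, TangentSpace I p →L[ℝ] TangentSpace I p →L[ℝ] ℝ

variable (I J) in
/-- The pullback `φ^* b`, `(φ^* b)_p(v, w) = b_{φ p}(dφ_p v, dφ_p w)`. -/
def pullback (φ : M → N) (b : BilinField J N) : BilinField I M := fun p =>
  bilinComp (b (φ p)) (mfderiv I J φ p)

/-- The coordinate expression of `b` in the preferred chart at `p`. -/
def inChart (b : BilinField I M) (p : M) : E → E →L[ℝ] E →L[ℝ] ℝ :=
  pullback 𝓘(ℝ, E) I (extChartAt I p).symm b

variable (I M) in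
/-- A smooth semi-Riemannian metric: a smooth field of nondegenerate symmetric bilinear forms. -/
structure SemiRiemannianMetric where
  toFun : BilinField I M
  symm : ∀ p v w, toFun p v w = toFun p w v
  nondegenerate : ∀ p v, (∀ w, toFun p v w = 0) → v = 0
  smooth : ∀ p, ContDiffOn ℝ ∞ (inChart toFun p) (extChartAt I p).target

variable (I) in
/-- The differential `dh` of a function. -/
def differential (h : M → ℝ) (p : M) : TangentSpace I p →L[ℝ] ℝ :=
  mfderiv I 𝓘(ℝ, ℝ) h p

namespace SemiRiemannianMetric

variable (g : SemiRiemannianMetric I M)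

/-- The Ricci tensor of `g` at `p`, computed in the preferred chart at `p`. -/
def ricci (p : M) (v w : TangentSpace I p) : ℝ :=
  coordRicci (inChart g.toFun p) (extChartAt I p p)
    (mfderiv I 𝓘(ℝ, E) (extChartAt I p) p v) (mfderiv I 𝓘(ℝ, E) (extChartAt I p) p w)

/-- The Hessian of a function `h` at `p`, computed in the preferred chart at `p`. -/
def hessian (h : M → ℝ) : BilinField I M := fun p =>
  bilinComp (coordHessian (inChart g.toFun p) (h ∘ (extChartAt I p).symm) (extChartAt I p p))
    (mfderiv I 𝓘(ℝ, E) (extChartAt I p) p)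

/-- The gradient: `g(∇h, v) = dh(v)` for all `v`. -/
def grad (h : M → ℝ) (p : M) : TangentSpace I p :=
  (g.toFun p).inverse (differential I h p)

/-- The tension field `trace_g (∇ du)` of a map `u : M → (ℝ, dr²)`, i.e. its Laplacian. -/
def tension (u : M → ℝ) (p : M) : ℝ :=
  metricTrace (g.toFun p) (g.hessian u p)

/-- `Ric_g = μ g`. -/
def IsEinsteinWith (μ : ℝ) : Prop :=
  ∀ (p : M) (v w : TangentSpace I p), g.ricci p v w = μ * g.toFun p v w

/-- `Ric_g = 0`. -/
def IsRicciFlat : Prop :=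
  ∀ (p : M) (v w : TangentSpace I p), g.ricci p v w = 0

/-- `((M, g), (ℝ, dr²), u, h, lam)` is a gradient Ricci-harmonic soliton: `h`, `u` are smooth and,
for some constant `θ ≥ 0`, `Ric_g + Hess h - θ ∇u ⊗ ∇u = lam g` (where `(∇u ⊗ ∇u)(v, w) = du(v) du(w)`) and
`τ_g u - g(∇u, ∇h) = 0`. -/
structure IsGRHS (h u : M → ℝ) (lam : ℝ) : Prop where
  smooth_potential : ContMDiff I 𝓘(ℝ, ℝ) ∞ h
  smooth_map : ContMDiff I 𝓘(ℝ, ℝ) ∞ u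
  soliton : ∃ θ : ℝ, 0 ≤ θ ∧ ∀ (p : M) (v w : TangentSpace I p),
    g.ricci p v w + g.hessian h p v w
      - θ * (differential I u p v * differential I u p w) = lam * g.toFun p v w
  harmonic : ∀ p : M, g.tension u p - g.toFun p (g.grad u p) (g.grad h p) = 0

end SemiRiemannianMetric

/-! ## Warped products -/

/-- The tensor field `π^* g_B + (f ∘ π)² σ^* g_F` on `B × F`. -/
def warpedField (gB : BilinField I M) (gF : BilinField J N) (f : M → ℝ) :
    BilinField (I.prod J) (M × N) := fun p =>
  pullback (I.prod J) I Prod.fst gB p + (f p.1) ^ 2 • pullback (I.prod J) J Prod.snd gF p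

theorem warpedField_apply (gB : BilinField I M) (gF : BilinField J N) (f : M → ℝ)
    (p : M × N) (v w : TangentSpace (I.prod J) p) :
    warpedField gB gF f p v w = gB p.1 v.1 w.1 + (f p.1) ^ 2 * gF p.2 v.2 w.2 := by
  simp only [warpedField, pullback, mfderiv_fst, mfderiv_snd]
  rfl

theorem inChart_apply (b : BilinField I M) (p : M) (x : E) :
    inChart b p x = bilinComp (b ((extChartAt I p).symm x))
      (mfderiv 𝓘(ℝ, E) I (extChartAt I p).symm x) := rfl

theorem inChart_warpedField [I.Boundaryless] [J.Boundaryless] [IsManifold I ∞ M]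
    [IsManifold J ∞ N] (gB : BilinField I M) (gF : BilinField J N) (f : M → ℝ) (p : M × N)
    (x : E × E') (hx : x ∈ (extChartAt (I.prod J) p).target) :
    inChart (warpedField gB gF f) p x =
      bilinComp (inChart gB p.1 x.1) (.fst ℝ E E')
        + (f ((extChartAt I p.1).symm x.1)) ^ 2 •
          bilinComp (inChart gF p.2 x.2) (.snd ℝ E E') := by
  have hx1 : x.1 ∈ (extChartAt I p.1).target := by
    rw [extChartAt_prod] at hx
    exact hx.1
  have hx2 : x.2 ∈ (extChartAt J p.2).target := by
    rw [extChartAt_prod] at hx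
    exact hx.2
  have h1 : MDifferentiableAt 𝓘(ℝ, E) I (extChartAt I p.1).symm x.1 := by
    have := mdifferentiableWithinAt_extChartAt_symm (I := I) hx1
    rwa [I.range_eq_univ, mdifferentiableWithinAt_univ] at this
  have h2 : MDifferentiableAt 𝓘(ℝ, E') J (extChartAt J p.2).symm x.2 := by
    have := mdifferentiableWithinAt_extChartAt_symm (I := J) hx2
    rwa [J.range_eq_univ, mdifferentiableWithinAt_univ] at this
  have hs : ((extChartAt (I.prod J) p).symm : E × E' → M × N) =
      Prod.map (extChartAt I p.1).symm (extChartAt J p.2).symm := by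
    rw [extChartAt_prod]
    rfl
  have hd : mfderiv 𝓘(ℝ, E × E') (I.prod J) (extChartAt (I.prod J) p).symm x =
      (mfderiv 𝓘(ℝ, E) I (extChartAt I p.1).symm x.1).prodMap
        (mfderiv 𝓘(ℝ, E') J (extChartAt J p.2).symm x.2) := by
    rw [hs, modelWithCornersSelf_prod, ← chartedSpaceSelf_prod]
    exact mfderiv_prodMap h1 h2
  refine ContinuousLinearMap.ext fun v => ContinuousLinearMap.ext fun w => ?_
  rw [inChart_apply, hd]
  change warpedField gB gF f ((extChartAt (I.prod J) p).symm x) _ _ = _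
  rw [warpedField_apply, hs]
  rfl

theorem contDiff_bilinComp {V W : Type*} [NormedAddCommGroup V] [NormedSpace ℝ V]
    [NormedAddCommGroup W] [NormedSpace ℝ W] (A : V →L[ℝ] W) :
    ContDiff ℝ ∞ (fun b : W →L[ℝ] W →L[ℝ] ℝ => bilinComp b A) := by
  unfold bilinComp
  fun_prop

/-- The warped product `M ×_f N`: the manifold `M × N` with the metric
`π^* g_B + (f ∘ π)² σ^* g_F`, where `f : M → ℝ` is smooth and positive. -/
def warpedProduct [I.Boundaryless] [J.Boundaryless] [IsManifold I ∞ M] [IsManifold J ∞ N]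
    (gB : SemiRiemannianMetric I M) (gF : SemiRiemannianMetric J N) (f : M → ℝ)
    (hf : ContMDiff I 𝓘(ℝ, ℝ) ∞ f) (hpos : ∀ p, 0 < f p) :
    SemiRiemannianMetric (I.prod J) (M × N) where
  toFun := warpedField gB.toFun gF.toFun f
  symm p v w := by
    refine (warpedField_apply _ _ _ p v w).trans
      (Eq.trans ?_ (warpedField_apply _ _ _ p w v).symm)
    exact congrArg₂ (· + (f p.1) ^ 2 * ·) (gB.symm p.1 v.1 w.1) (gF.symm p.2 v.2 w.2)
  nondegenerate p v hv := by
    refine Prod.ext (gB.nondegenerate p.1 v.1 fun w => ?_) (gF.nondegenerate p.2 v.2 fun w => ?_)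
    · have := (warpedField_apply _ _ _ p v (w, (0 : E'))).symm.trans (hv (w, (0 : E')))
      have h0 : gF.toFun p.2 v.2 (0 : TangentSpace J p.2) = 0 := map_zero _
      change gB.toFun p.1 v.1 w + (f p.1) ^ 2 * gF.toFun p.2 v.2 (0 : TangentSpace J p.2) = 0
        at this
      rw [h0] at this
      simpa using this
    · have := (warpedField_apply _ _ _ p v ((0 : E), w)).symm.trans (hv ((0 : E), w))
      have h0 : gB.toFun p.1 v.1 (0 : TangentSpace I p.1) = 0 := map_zero _
      change gB.toFun p.1 v.1 (0 : TangentSpace I p.1) + (f p.1) ^ 2 * gF.toFun p.2 v.2 w = 0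
        at this
      rw [h0, zero_add] at this
      exact (mul_eq_zero.1 this).resolve_left (pow_pos (hpos _) 2).ne'
  smooth p := by
    refine ContDiffOn.congr ?_ (inChart_warpedField gB.toFun gF.toFun f p)
    have hm1 : Set.MapsTo Prod.fst (extChartAt (I.prod J) p).target
        (extChartAt I p.1).target := fun x hx => by
      rw [extChartAt_prod] at hx
      exact hx.1
    have hm2 : Set.MapsTo Prod.snd (extChartAt (I.prod J) p).target
        (extChartAt J p.2).target := fun x hx => by
      rw [extChartAt_prod] at hx
      exact hx.2
    have hB := (gB.smooth p.1).comp (contDiff_fst (𝕜 := ℝ) (n := ∞)).contDiffOn hm1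
    have hF := (gF.smooth p.2).comp (contDiff_snd (𝕜 := ℝ) (n := ∞)).contDiffOn hm2
    have hf' : ContDiffOn ℝ ∞ (fun y => f ((extChartAt I p.1).symm y)) (extChartAt I p.1).target :=
      contMDiffOn_iff_contDiffOn.1 (hf.comp_contMDiffOn (contMDiffOn_extChartAt_symm p.1))
    have hf'' := hf'.comp (contDiff_fst (𝕜 := ℝ) (n := ∞)).contDiffOn hm1
    exact ((contDiff_bilinComp _).comp_contDiffOn hB).add
      ((hf''.pow 2).smul ((contDiff_bilinComp _).comp_contDiffOn hF))

end Manifolds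

/-! ## Conformal semi-Euclidean spaces -/

section SemiEuclidean

variable {n : ℕ}

/-- The semi-Euclidean scalar product `g₀(v, w) = ∑ εᵢ vᵢ wᵢ` on `ℝⁿ`, with `εᵢ = ±1`. -/
def semiEuclidean (ε : Fin n → ℤˣ) :
    EuclideanSpace ℝ (Fin n) →L[ℝ] EuclideanSpace ℝ (Fin n) →L[ℝ] ℝ :=
  ∑ i, ((ε i : ℤ) : ℝ) •
    (EuclideanSpace.proj i : EuclideanSpace ℝ (Fin n) →L[ℝ] ℝ).smulRight
      (EuclideanSpace.proj i : EuclideanSpace ℝ (Fin n) →L[ℝ] ℝ)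

theorem semiEuclidean_apply (ε : Fin n → ℤˣ) (v w : EuclideanSpace ℝ (Fin n)) :
    semiEuclidean ε v w = ∑ i, ((ε i : ℤ) : ℝ) * (v i * w i) := by
  simp [semiEuclidean]

theorem semiEuclidean_symm (ε : Fin n → ℤˣ) (v w : EuclideanSpace ℝ (Fin n)) :
    semiEuclidean ε v w = semiEuclidean ε w v := by
  simp only [semiEuclidean_apply, mul_comm (v _)]

theorem semiEuclidean_nondegenerate (ε : Fin n → ℤˣ) (v : EuclideanSpace ℝ (Fin n))
    (hv : ∀ w, semiEuclidean ε v w = 0) : v = 0 := by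
  ext i
  have h := hv (EuclideanSpace.single i (1 : ℝ))
  rw [semiEuclidean_apply] at h
  simpa [Pi.single_apply] using h

theorem inChart_self {E : Type*} [NormedAddCommGroup E] [NormedSpace ℝ E]
    (b : BilinField 𝓘(ℝ, E) E) (p x : E) : inChart b p x = b x := by
  have hd : mfderiv 𝓘(ℝ, E) 𝓘(ℝ, E) (extChartAt 𝓘(ℝ, E) p).symm x = .id ℝ E := by
    rw [extChartAt_model_space_eq_id]
    exact mfderiv_id
  rw [inChart_apply, hd]
  rfl

/-- The metric `φ⁻² g₀` on `ℝⁿ`, where `φ : ℝⁿ → ℝ` is smooth and has no zeros. -/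
def conformalMetric (ε : Fin n → ℤˣ) (φ : EuclideanSpace ℝ (Fin n) → ℝ)
    (hφ : ContDiff ℝ ∞ φ) (hφ0 : ∀ x, φ x ≠ 0) :
    SemiRiemannianMetric (𝓡 n) (EuclideanSpace ℝ (Fin n)) where
  toFun x := ((φ x) ^ 2)⁻¹ • semiEuclidean ε
  symm x v w := by
    exact congrArg (((φ x) ^ 2)⁻¹ * ·) (semiEuclidean_symm ε v w)
  nondegenerate x v hv := by
    exact semiEuclidean_nondegenerate ε v fun w =>
      (mul_eq_zero.1 (hv w)).resolve_left (inv_ne_zero (pow_ne_zero 2 (hφ0 x)))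
  smooth p := by
    refine ContDiffOn.congr (f := fun x => ((φ x) ^ 2)⁻¹ • semiEuclidean ε) ?_
      (fun x _ => inChart_self _ p x)
    exact (((hφ.pow 2).inv fun x => pow_ne_zero 2 (hφ0 x)).smul contDiff_const).contDiffOn

/-- The linear function `ξ(x) = ∑ αᵢ xᵢ` on `ℝⁿ`. -/
def xi (α x : EuclideanSpace ℝ (Fin n)) : ℝ := ∑ i, α i * x i

theorem contDiff_xi (α : EuclideanSpace ℝ (Fin n)) : ContDiff ℝ ∞ (xi α) := by
  unfold xi
  fun_prop

end SemiEuclidean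

end SemiRiem

end

open SemiRiem

/-! If `‖α‖² = 0`, then the `g₀`-gradient `k` of `ξ`, a constant vector field on `ℝⁿ`, is null and
Killing for `φ⁻² g₀`, and its dual one-form `φ⁻² dξ` is closed. Hence `k` is parallel, also for the
warped product, and `h` and `u` are invariant along it. So `Ric(k, ·)`, `Hess h(k, ·)` and `du(k)`
vanish, and the soliton equation on `(k, e)` leaves `λ g(k, e) = 0`.

On vectors tangent to the fiber, O'Neill's formula corrects `Ric_F` only by multiples of
`div (grad f²)` and `|grad f²|²`, and `Hess h` is a multiple of `dh(grad f²)`. All three vanish: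
`grad f²` is a multiple of `k` by a function of `ξ`, which is constant along `k`. -/

noncomputable section

namespace SemiRiem

open Filter Module Topology

section LinearAlgebra

variable {V W : Type*} [NormedAddCommGroup V] [NormedSpace ℝ V] [FiniteDimensional ℝ V]
  [NormedAddCommGroup W] [NormedSpace ℝ W] [FiniteDimensional ℝ W]

theorem isInvertible_of_nondegenerate {b : V →L[ℝ] V →L[ℝ] ℝ}
    (hb : ∀ v, (∀ w, b v w = 0) → v = 0) : b.IsInvertible := by
  have hinj : Function.Injective (b : V →ₗ[ℝ] V →L[ℝ] ℝ) :=
    (injective_iff_map_eq_zero _).2 fun v hv => hb v (DFunLike.congr_fun hv)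
  have hfinrank : finrank ℝ V = finrank ℝ (V →L[ℝ] ℝ) :=
    (Subspace.dual_finrank_eq (K := ℝ) (V := V)).symm.trans
      (LinearMap.toContinuousLinearMap (𝕜 := ℝ) (E := V) (F' := ℝ)).finrank_eq
  exact ⟨(LinearEquiv.ofInjectiveOfFinrankEq _ hinj hfinrank).toContinuousLinearEquiv, rfl⟩

theorem trace_eq_trace_blocks (T : V × W →ₗ[ℝ] V × W) :
    LinearMap.trace ℝ (V × W) T =
      LinearMap.trace ℝ V (.fst ℝ V W ∘ₗ T ∘ₗ .inl ℝ V W) +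
        LinearMap.trace ℝ W (.snd ℝ V W ∘ₗ T ∘ₗ .inr ℝ V W) := by
  have hT : T = (T ∘ₗ .inl ℝ V W) ∘ₗ .fst ℝ V W + (T ∘ₗ .inr ℝ V W) ∘ₗ .snd ℝ V W :=
    LinearMap.ext fun x => by simp [← map_add]
  conv_lhs => rw [hT, map_add, LinearMap.trace_comp_comm',
    LinearMap.trace_comp_comm' (LinearMap.snd ℝ V W)]

end LinearAlgebra

section Calculus

variable {E X Y Z Z' : Type*} [NormedAddCommGroup E] [NormedSpace ℝ E]
  [NormedAddCommGroup X] [NormedSpace ℝ X] [NormedAddCommGroup Y] [NormedSpace ℝ Y]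
  [NormedAddCommGroup Z] [NormedSpace ℝ Z] [NormedAddCommGroup Z'] [NormedSpace ℝ Z']

theorem fderiv_apply_eq_zero_of_invariant {Φ : E → X} {k : E}
    (hΦ : ∀ (x : E) (s : ℝ), Φ (x + s • k) = Φ x) (x : E) : fderiv ℝ Φ x k = 0 := by
  by_cases hd : DifferentiableAt ℝ Φ x
  · simp [← hd.lineDeriv_eq_fderiv, lineDeriv, hΦ]
  · simp [fderiv_zero_of_not_differentiableAt hd]

theorem fderiv_invariant {Φ : E → X} {k : E} (hΦ : ∀ (x : E) (s : ℝ), Φ (x + s • k) = Φ x)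
    (x : E) (s : ℝ) : fderiv ℝ Φ (x + s • k) = fderiv ℝ Φ x := by
  rw [← fderiv_comp_add_right]
  simp only [hΦ]

theorem fderiv_comp_clm_apply_apply {Φ : X → E →L[ℝ] E →L[ℝ] Z} {i : Y → X} {A : Y →L[ℝ] X}
    {y : Y} (hΦ : DifferentiableAt ℝ Φ (i y)) (hi : HasFDerivAt i A y) (L : Z →L[ℝ] Z')
    (v : Y) (w z : E) :
    fderiv ℝ (fun y => L (Φ (i y) w z)) y v = L (fderiv ℝ Φ (i y) (A v) w z) := by
  have hd := L.hasFDerivAt.comp y <| ((hΦ.hasFDerivAt.comp y hi).clm_apply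
    (hasFDerivAt_const w y)).clm_apply (hasFDerivAt_const z y)
  refine (congrArg (· v) hd.fderiv).trans ?_
  simp

theorem fderiv_clm_apply_apply {Φ : X → E →L[ℝ] E →L[ℝ] Z} {x : X} (hΦ : DifferentiableAt ℝ Φ x)
    (v : X) (w z : E) : fderiv ℝ (fun y => Φ y w z) x v = fderiv ℝ Φ x v w z :=
  fderiv_comp_clm_apply_apply hΦ (hasFDerivAt_id x) (.id ℝ Z) v w z

end Calculus

section LeviCivita

variable {E : Type*} [NormedAddCommGroup E] [NormedSpace ℝ E]
  {G G' : E → E →L[ℝ] E →L[ℝ] ℝ} {x k : E}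

theorem christoffel_eventuallyEq (h : G =ᶠ[𝓝 x] G') : christoffel G =ᶠ[𝓝 x] christoffel G' := by
  filter_upwards [h.eventuallyEq_nhds] with y hy
  simp only [christoffel, christoffelFirst, hy.fderiv_eq, hy.eq_of_nhds]

theorem coordRicci_congr (h : G =ᶠ[𝓝 x] G') : coordRicci G x = coordRicci G' x := by
  have hΓ := christoffel_eventuallyEq h
  simp only [funext_iff, coordRicci, curvatureEnd, hΓ.fderiv_eq, hΓ.eq_of_nhds, implies_true]

theorem coordHessian_congr (h : G =ᶠ[𝓝 x] G') (H : E → ℝ) :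
    coordHessian G H x = coordHessian G' H x := by
  rw [coordHessian, coordHessian, (christoffel_eventuallyEq h).eq_of_nhds]

theorem coordHessian_apply (G : E → E →L[ℝ] E →L[ℝ] ℝ) (H : E → ℝ) (x v w : E) :
    coordHessian G H x v w =
      fderiv ℝ (fderiv ℝ H) x v w - fderiv ℝ H x (christoffel G x v w) := rfl

theorem metric_christoffel_apply (hG : (G x).IsInvertible) (v w z : E) :
    G x (christoffel G x v w) z = christoffelFirst G x v w z := by
  rw [christoffel_apply, hG.self_apply_inverse]

theorem christoffel_eq_iff (hG : (G x).IsInvertible) {v w u : E} :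
    christoffel G x v w = u ↔ ∀ z, G x u z = christoffelFirst G x v w z := by
  rw [christoffel_apply, hG.inverse_apply_eq, eq_comm, ContinuousLinearMap.ext_iff]

theorem christoffel_comm (hG : DifferentiableAt ℝ G x) (hsymm : ∀ y v w, G y v w = G y w v)
    (v w : E) : christoffel G x v w = christoffel G x w v := by
  have hfirst : christoffelFirst G x v w = christoffelFirst G x w v :=
    ContinuousLinearMap.ext fun z => by
      have hD : fderiv ℝ G x z v w = fderiv ℝ G x z w v := by
        simp only [← fderiv_clm_apply_apply hG, hsymm _ v w]
      rw [christoffelFirst_apply, christoffelFirst_apply, hD, add_comm (fderiv ℝ G x v w z)]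
  rw [christoffel_apply, christoffel_apply, hfirst]

/-- The coordinate expression `G` of a metric is `C²` and nondegenerate at `x`: what it takes for
the curvature at `x` to be meaningful. -/
structure IsRegularMetricAt (G : E → E →L[ℝ] E →L[ℝ] ℝ) (x : E) : Prop where
  contDiffAt : ContDiffAt ℝ 2 G x
  isInvertible : (G x).IsInvertible

namespace IsRegularMetricAt

theorem differentiableAt (hG : IsRegularMetricAt G x) : DifferentiableAt ℝ G x :=
  hG.contDiffAt.differentiableAt two_ne_zero

variable [CompleteSpace E]

theorem eventually (hG : IsRegularMetricAt G x) : ∀ᶠ y in 𝓝 x, IsRegularMetricAt G y := by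
  obtain ⟨e, he⟩ := hG.isInvertible
  have hinv : ∀ᶠ y in 𝓝 x, (G y).IsInvertible :=
    hG.contDiffAt.continuousAt.eventually (he ▸ e.nhds)
  filter_upwards [hG.contDiffAt.eventually (by decide), hinv] with y hy hy' using ⟨hy, hy'⟩

theorem differentiableAt_christoffel (hG : IsRegularMetricAt G x) :
    DifferentiableAt ℝ (christoffel G) x := by
  have hD : DifferentiableAt ℝ (fderiv ℝ G) x :=
    (hG.contDiffAt.fderiv_right (m := 1) (by norm_num)).differentiableAt one_ne_zero
  have hinv : DifferentiableAt ℝ (fun y => (G y).inverse) x :=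
    ((hG.isInvertible.contDiffAt_map_inverse (n := 1)).differentiableAt one_ne_zero).comp x
      hG.differentiableAt
  have hflip : DifferentiableAt ℝ (fun y => (fderiv ℝ G y).flip) x :=
    (ContinuousLinearMap.flipₗᵢ ℝ E E (E →L[ℝ] ℝ)).toContinuousLinearEquiv.differentiableAt.comp
      x hD
  have hfirst : DifferentiableAt ℝ (christoffelFirst G) x :=
    ((hD.add hflip).sub ((differentiableAt_const _).clm_comp hflip)).const_smul (1 / 2 : ℝ)
  exact ((ContinuousLinearMap.compL ℝ E (E →L[ℝ] ℝ) E).differentiableAt.comp x hinv).clm_comp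
    hfirst

end IsRegularMetricAt

/-- The gradient of `h` in coordinates: `G x (coordGradient G h x) v = Dh(v)`. -/
def coordGradient (G : E → E →L[ℝ] E →L[ℝ] ℝ) (h : E → ℝ) (x : E) : E :=
  (G x).inverse (fderiv ℝ h x)

/-- The covariant derivative `v ↦ ∇_v Y = D_v Y + Γ(v, Y)` of a vector field in coordinates. -/
def coordCovDeriv (G : E → E →L[ℝ] E →L[ℝ] ℝ) (Y : E → E) (x : E) : E →L[ℝ] E :=
  fderiv ℝ Y x + (christoffel G x).flip (Y x)

/-- The divergence of a vector field in coordinates: `div Y = tr (v ↦ ∇_v Y)`. -/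
def coordDivergence (G : E → E →L[ℝ] E →L[ℝ] ℝ) (Y : E → E) (x : E) : ℝ :=
  LinearMap.trace ℝ E (coordCovDeriv G Y x)

theorem metric_coordGradient (hG : (G x).IsInvertible) (h : E → ℝ) :
    G x (coordGradient G h x) = fderiv ℝ h x :=
  hG.self_apply_inverse _

theorem coordDivergence_smul_of_parallel [FiniteDimensional ℝ E] {c : E → ℝ}
    (hc : DifferentiableAt ℝ c x) (hk : ∀ v, christoffel G x v k = 0) :
    coordDivergence G (fun y => c y • k) x = fderiv ℝ c x k := by
  have hcov : (coordCovDeriv G (fun y => c y • k) x : E →ₗ[ℝ] E) =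
      (fderiv ℝ c x : E →ₗ[ℝ] ℝ).smulRight k := by
    ext v
    simp [coordCovDeriv, fderiv_smul_const hc, hk]
  rw [coordDivergence, hcov, LinearMap.trace_smulRight, ContinuousLinearMap.coe_coe]

/-- A constant vector field `k` is parallel if it is Killing (`D_k G = 0`) and its dual one-form
`G(k, ·)` is closed. -/
theorem christoffel_eq_zero_of_fderiv_eq_zero (hkilling : fderiv ℝ G x k = 0)
    (hclosed : ∀ w z, fderiv ℝ G x w k z = fderiv ℝ G x z k w) : christoffel G x k = 0 := by
  have hfirst : christoffelFirst G x k = 0 := by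
    ext w z
    simp [christoffelFirst_apply, hkilling, hclosed w z]
  ext w
  rw [christoffel_apply, hfirst, zero_apply, map_zero, zero_apply]

theorem christoffel_invariant (hG : ∀ (y : E) (s : ℝ), G (y + s • k) = G y) (y : E) (s : ℝ) :
    christoffel G (y + s • k) = christoffel G y := by
  simp only [christoffel, christoffelFirst, fderiv_invariant hG, hG]

theorem coordRicci_eq_zero_of_parallel (hinv : ∀ (y : E) (s : ℝ), G (y + s • k) = G y)
    (hΓ : DifferentiableAt ℝ (christoffel G) x) (hk : ∀ᶠ y in 𝓝 x, christoffel G y k = 0)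
    (z : E) : coordRicci G x k z = 0 := by
  have hD (v : E) : fderiv ℝ (christoffel G) x v k z = 0 := by
    have hconst : (fun y => christoffel G y k z) =ᶠ[𝓝 x] fun _ => 0 := by
      filter_upwards [hk] with y hy
      rw [hy, zero_apply]
    rw [← fderiv_clm_apply_apply hΓ, hconst.fderiv_eq, fderiv_const_apply, zero_apply]
  have hR : curvatureEnd G x k z = 0 := LinearMap.ext fun v => by
    simp [curvatureEnd, hD, hk.self_of_nhds,
      fderiv_apply_eq_zero_of_invariant (christoffel_invariant hinv)]
  rw [coordRicci, hR, map_zero]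

theorem coordHessian_eq_zero_of_parallel {H : E → ℝ} (hH : ∀ (y : E) (s : ℝ), H (y + s • k) = H y)
    (hk : christoffel G x k = 0) (z : E) : coordHessian G H x k z = 0 := by
  simp [coordHessian_apply, hk, fderiv_apply_eq_zero_of_invariant (fderiv_invariant hH)]

end LeviCivita

section WarpedCoordinates

variable {E E' : Type*} [NormedAddCommGroup E] [NormedSpace ℝ E]
  [NormedAddCommGroup E'] [NormedSpace ℝ E']

/-- The coordinate expression `B(x) + κ(x) γ(y)` of a warped product metric; the warping function
`f` of the product enters through `κ = f²`. -/
def warpedCoord (B : E → E →L[ℝ] E →L[ℝ] ℝ) (κ : E → ℝ) (γ : E' → E' →L[ℝ] E' →L[ℝ] ℝ)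
    (x : E × E') : E × E' →L[ℝ] E × E' →L[ℝ] ℝ :=
  bilinComp (B x.1) (.fst ℝ E E') + κ x.1 • bilinComp (γ x.2) (.snd ℝ E E')

variable {B : E → E →L[ℝ] E →L[ℝ] ℝ} {κ : E → ℝ} {γ : E' → E' →L[ℝ] E' →L[ℝ] ℝ}
  {x : E × E'} {k : E}

theorem warpedCoord_apply (x v w : E × E') :
    warpedCoord B κ γ x v w = B x.1 v.1 w.1 + κ x.1 * γ x.2 v.2 w.2 := rfl

theorem differentiableAt_warpedCoord (hB : DifferentiableAt ℝ B x.1)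
    (hκ : DifferentiableAt ℝ κ x.1) (hγ : DifferentiableAt ℝ γ x.2) :
    DifferentiableAt ℝ (warpedCoord B κ γ) x :=
  (((contDiff_bilinComp (.fst ℝ E E')).differentiable (by decide) _).comp x
    (hB.comp x differentiableAt_fst)).add <| (hκ.comp x differentiableAt_fst).smul <|
      ((contDiff_bilinComp (.snd ℝ E E')).differentiable (by decide) _).comp x
        (hγ.comp x differentiableAt_snd)

theorem fderiv_warpedCoord_apply (hB : DifferentiableAt ℝ B x.1) (hκ : DifferentiableAt ℝ κ x.1)
    (hγ : DifferentiableAt ℝ γ x.2) (v w z : E × E') :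
    fderiv ℝ (warpedCoord B κ γ) x v w z =
      fderiv ℝ B x.1 v.1 w.1 z.1 + fderiv ℝ κ x.1 v.1 * γ x.2 w.2 z.2
        + κ x.1 * fderiv ℝ γ x.2 v.2 w.2 z.2 := by
  have hB' := ((hB.hasFDerivAt.comp x hasFDerivAt_fst).clm_apply
    (hasFDerivAt_const w.1 x)).clm_apply (hasFDerivAt_const z.1 x)
  have hγ' := ((hγ.hasFDerivAt.comp x hasFDerivAt_snd).clm_apply
    (hasFDerivAt_const w.2 x)).clm_apply (hasFDerivAt_const z.2 x)
  have hsum := hB'.add ((hκ.hasFDerivAt.comp x hasFDerivAt_fst).mul hγ')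
  rw [← fderiv_clm_apply_apply (differentiableAt_warpedCoord hB hκ hγ)]
  refine (congrArg (· v) hsum.fderiv).trans ?_
  simp only [Function.comp_apply, ContinuousLinearMap.comp_zero, zero_add, add_apply,
    ContinuousLinearMap.flip_apply, ContinuousLinearMap.comp_apply, ContinuousLinearMap.coe_fst',
    smul_apply, ContinuousLinearMap.coe_snd', smul_eq_mul]
  ring

variable [FiniteDimensional ℝ E] [FiniteDimensional ℝ E']

theorem isRegularMetricAt_warpedCoord (hB : IsRegularMetricAt B x.1) (hκ : ContDiffAt ℝ 2 κ x.1)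
    (hκ0 : κ x.1 ≠ 0) (hγ : IsRegularMetricAt γ x.2) :
    IsRegularMetricAt (warpedCoord B κ γ) x where
  contDiffAt :=
    have hfst := (contDiff_bilinComp (.fst ℝ E E')).of_le (m := 2) (by norm_cast)
    have hsnd := (contDiff_bilinComp (.snd ℝ E E')).of_le (m := 2) (by norm_cast)
    (hfst.contDiffAt.comp x (hB.contDiffAt.comp x contDiffAt_fst)).add <|
      (hκ.comp x contDiffAt_fst).smul
        (hsnd.contDiffAt.comp x (hγ.contDiffAt.comp x contDiffAt_snd))
  isInvertible := isInvertible_of_nondegenerate fun v hv => by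
    refine Prod.ext (hB.isInvertible.injective ?_) (hγ.isInvertible.injective ?_) <;>
      refine ContinuousLinearMap.ext fun w => ?_
    · simpa [warpedCoord_apply] using hv (w, 0)
    · simpa [warpedCoord_apply, hκ0] using hv (0, w)

theorem christoffel_warpedCoord (hB : IsRegularMetricAt B x.1) (hκ : ContDiffAt ℝ 2 κ x.1)
    (hκ0 : κ x.1 ≠ 0) (hγ : IsRegularMetricAt γ x.2) (v w : E × E') :
    christoffel (warpedCoord B κ γ) x v w =
      (christoffel B x.1 v.1 w.1 - (γ x.2 v.2 w.2 / 2) • coordGradient B κ x.1,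
        christoffel γ x.2 v.2 w.2
          + (2 * κ x.1)⁻¹ • (fderiv ℝ κ x.1 v.1 • w.2 + fderiv ℝ κ x.1 w.1 • v.2)) := by
  refine (christoffel_eq_iff (isRegularMetricAt_warpedCoord hB hκ hκ0 hγ).isInvertible).2
    fun z => ?_
  have hD := fderiv_warpedCoord_apply hB.differentiableAt (hκ.differentiableAt two_ne_zero)
    hγ.differentiableAt
  simp only [christoffelFirst_apply, warpedCoord_apply, hD, map_add, map_sub, map_smul, add_apply,
    sub_apply, smul_apply, smul_eq_mul, metric_christoffel_apply hB.isInvertible,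
    metric_christoffel_apply hγ.isInvertible, metric_coordGradient hB.isInvertible]
  field

theorem christoffel_warpedCoord_inl_eq_zero (hB : IsRegularMetricAt B x.1)
    (hκ : ContDiffAt ℝ 2 κ x.1) (hκ0 : κ x.1 ≠ 0) (hγ : IsRegularMetricAt γ x.2)
    (hk : christoffel B x.1 k = 0) (hκk : fderiv ℝ κ x.1 k = 0) :
    christoffel (warpedCoord B κ γ) x (k, 0) = 0 :=
  ContinuousLinearMap.ext fun w => by simp [christoffel_warpedCoord hB hκ hκ0 hγ, hk, hκk]

theorem coordHessian_warpedCoord_fiber (hB : IsRegularMetricAt B x.1) (hκ : ContDiffAt ℝ 2 κ x.1)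
    (hκ0 : κ x.1 ≠ 0) (hγ : IsRegularMetricAt γ x.2) {H : E → ℝ}
    (hH : DifferentiableAt ℝ H x.1) (w z : E') :
    coordHessian (warpedCoord B κ γ) (fun y => H y.1) x (0, w) (0, z) =
      γ x.2 w z / 2 * fderiv ℝ H x.1 (coordGradient B κ x.1) := by
  have hDH : fderiv ℝ (fun y : E × E' => H y.1) x = fderiv ℝ H x.1 ∘L .fst ℝ E E' :=
    (hH.hasFDerivAt.comp x hasFDerivAt_fst).fderiv
  have hD2H : fderiv ℝ (fderiv ℝ fun y : E × E' => H y.1) x (0, w) = 0 :=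
    fderiv_apply_eq_zero_of_invariant (fderiv_invariant fun y s => by simp) x
  simp [coordHessian_apply, hD2H, hDH, christoffel_warpedCoord hB hκ hκ0 hγ]

/-- The part of `v ↦ R(v, w) z` along the base, for `w` and `z` tangent to the fiber. -/
theorem curvatureEnd_warpedCoord_inl_fst (hB : IsRegularMetricAt B x.1)
    (hκ : ContDiffAt ℝ 2 κ x.1) (hκ0 : κ x.1 ≠ 0) (hγ : IsRegularMetricAt γ x.2)
    (w z : E') (v : E) :
    (curvatureEnd (warpedCoord B κ γ) x (0, w) (0, z) (v, 0)).1 =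
      -(γ x.2 w z / 2) • (coordCovDeriv B (coordGradient B κ) x.1 v
        - ((2 * κ x.1)⁻¹ * fderiv ℝ κ x.1 v) • coordGradient B κ x.1) := by
  have hΓ := christoffel_warpedCoord hB hκ hκ0 hγ
  have hdΓ := (isRegularMetricAt_warpedCoord hB hκ hκ0 hγ).differentiableAt_christoffel
  have hDv : (fderiv ℝ (christoffel (warpedCoord B κ γ)) x (v, 0) (0, w) (0, z)).1 =
      -(γ x.2 w z / 2) • fderiv ℝ (coordGradient B κ) x.1 v := by
    have hfreeze : (fun x' => (christoffel (warpedCoord B κ γ) (x', x.2) (0, w) (0, z)).1) =ᶠ[𝓝 x.1]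
        -(γ x.2 w z / 2) • coordGradient B κ := by
      filter_upwards [hB.eventually, hκ.eventually (by decide), hκ.continuousAt.eventually_ne hκ0]
        with x' hB' hκ' hκ0'
      simp [christoffel_warpedCoord (x := (x', x.2)) hB' hκ' hκ0' hγ]
    have hsmul := congrFun (fderiv_const_smul_field (𝕜 := ℝ) (f := coordGradient B κ)
      (-(γ x.2 w z / 2))) x.1
    rw [← smul_apply, ← Pi.smul_apply, ← hsmul, ← hfreeze.fderiv_eq]
    exact (fderiv_comp_clm_apply_apply hdΓ (hasFDerivAt_prodMk_left x.1 x.2) (.fst ℝ E E')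
      v (0, w) (0, z)).symm
  have hDw : (fderiv ℝ (christoffel (warpedCoord B κ γ)) x (0, w) (v, 0) (0, z)).1 = 0 := by
    have hfreeze : (fun y' => (christoffel (warpedCoord B κ γ) (x.1, y') (v, 0) (0, z)).1) =ᶠ[𝓝 x.2]
        fun _ => 0 := by
      filter_upwards [hγ.eventually] with y' hγ'
      simp [christoffel_warpedCoord (x := (x.1, y')) hB hκ hκ0 hγ']
    have hzero := hfreeze.fderiv_eq (𝕜 := ℝ)
    rw [fderiv_const_apply] at hzero
    exact (fderiv_comp_clm_apply_apply hdΓ (hasFDerivAt_prodMk_right x.1 x.2) (.fst ℝ E E')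
      w (v, 0) (0, z)).symm.trans (congrArg (· w) hzero)
  simp only [curvatureEnd, LinearMap.coe_mk, AddHom.coe_mk, Prod.fst_add, Prod.fst_sub, hDv, hDw]
  simp only [neg_smul, sub_zero, hΓ, map_zero, zero_apply, zero_sub, mul_inv_rev, zero_smul,
    add_zero, smul_zero, map_neg, map_smul, zero_div, smul_eq_mul, zero_add, sub_self,
    sub_neg_eq_add, coordCovDeriv, add_apply, ContinuousLinearMap.flip_apply]
  module

/-- The part of `v ↦ R(v, w) z` along the fiber, for `w` and `z` tangent to the fiber. -/
theorem curvatureEnd_warpedCoord_inr_snd (hB : IsRegularMetricAt B x.1)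
    (hκ : ContDiffAt ℝ 2 κ x.1) (hκ0 : κ x.1 ≠ 0) (hγ : IsRegularMetricAt γ x.2)
    (w z v : E') :
    (curvatureEnd (warpedCoord B κ γ) x (0, w) (0, z) (0, v)).2 =
      curvatureEnd γ x.2 w z v
        - ((4 * κ x.1)⁻¹ * fderiv ℝ κ x.1 (coordGradient B κ x.1)) •
          (γ x.2 w z • v - γ x.2 v z • w) := by
  have hΓ := christoffel_warpedCoord hB hκ hκ0 hγ
  have hdΓ := (isRegularMetricAt_warpedCoord hB hκ hκ0 hγ).differentiableAt_christoffel
  have hD (v w : E') : (fderiv ℝ (christoffel (warpedCoord B κ γ)) x (0, v) (0, w) (0, z)).2 =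
      fderiv ℝ (christoffel γ) x.2 v w z := by
    have hfreeze : (fun y' => (christoffel (warpedCoord B κ γ) (x.1, y') (0, w) (0, z)).2) =ᶠ[𝓝 x.2]
        fun y' => christoffel γ y' w z := by
      filter_upwards [hγ.eventually] with y' hγ'
      simp [christoffel_warpedCoord (x := (x.1, y')) hB hκ hκ0 hγ']
    rw [← fderiv_clm_apply_apply hγ.differentiableAt_christoffel, ← hfreeze.fderiv_eq]
    exact (fderiv_comp_clm_apply_apply hdΓ (hasFDerivAt_prodMk_right x.1 x.2) (.snd ℝ E E')
      v (0, w) (0, z)).symm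
  simp only [curvatureEnd, LinearMap.coe_mk, AddHom.coe_mk, Prod.snd_add, Prod.snd_sub, hD]
  simp only [hΓ, map_zero, zero_apply, zero_sub, mul_inv_rev, zero_smul, add_zero, smul_zero,
    map_neg, map_smul, smul_eq_mul, neg_smul, zero_add, smul_neg]
  module

/-- O'Neill's formula for the Ricci curvature of a warped product on vectors tangent to the
fiber, written in terms of `κ = f²`. -/
theorem coordRicci_warpedCoord_fiber (hB : IsRegularMetricAt B x.1)
    (hκ : ContDiffAt ℝ 2 κ x.1) (hκ0 : κ x.1 ≠ 0) (hγ : IsRegularMetricAt γ x.2) (w z : E') :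
    coordRicci (warpedCoord B κ γ) x (0, w) (0, z) =
      coordRicci γ x.2 w z - γ x.2 w z / 2 * (coordDivergence B (coordGradient B κ) x.1
        + (finrank ℝ E' - 2) * (2 * κ x.1)⁻¹ * fderiv ℝ κ x.1 (coordGradient B κ x.1)) := by
  set q := coordGradient B κ x.1
  set R := curvatureEnd (warpedCoord B κ γ) x (0, w) (0, z)
  have hbase : .fst ℝ E E' ∘ₗ R ∘ₗ .inl ℝ E E' =
      -(γ x.2 w z / 2) • ((coordCovDeriv B (coordGradient B κ) x.1 : E →ₗ[ℝ] E)
        - (2 * κ x.1)⁻¹ • (fderiv ℝ κ x.1 : E →ₗ[ℝ] ℝ).smulRight q) :=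
    LinearMap.ext fun v =>
      (curvatureEnd_warpedCoord_inl_fst hB hκ hκ0 hγ w z v).trans (by simp [q, mul_smul])
  have hfiber : .snd ℝ E E' ∘ₗ R ∘ₗ .inr ℝ E E' =
      curvatureEnd γ x.2 w z - ((4 * κ x.1)⁻¹ * fderiv ℝ κ x.1 q) • (γ x.2 w z • LinearMap.id
        - ((γ x.2).flip z : E' →ₗ[ℝ] ℝ).smulRight w) :=
    LinearMap.ext fun v =>
      (curvatureEnd_warpedCoord_inr_snd hB hκ hκ0 hγ w z v).trans (by simp [q])
  rw [coordRicci, trace_eq_trace_blocks, hbase, hfiber]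
  simp only [map_sub, map_smul, LinearMap.trace_smulRight, LinearMap.trace_id, smul_eq_mul,
    ContinuousLinearMap.coe_coe, ContinuousLinearMap.flip_apply, coordRicci, coordDivergence]
  field

end WarpedCoordinates

section Brinkmann

variable {E E' : Type*} [NormedAddCommGroup E] [NormedSpace ℝ E]
  [NormedAddCommGroup E'] [NormedSpace ℝ E']

/-- `B` is a Brinkmann metric (a generalized pp-wave) on a vector space: the constant vector field
`k` is null and Killing, and its dual one-form `B(k, ·) = ψ(l) dl` is a nowhere vanishing multiple
of the differential of a linear function `l`. Such a `k` is parallel. -/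
structure IsBrinkmann (B : E → E →L[ℝ] E →L[ℝ] ℝ) (l : E →L[ℝ] ℝ) (k : E) (ψ : ℝ → ℝ) : Prop where
  invariant : ∀ (x : E) (s : ℝ), B (x + s • k) = B x
  lower : ∀ x, B x k = ψ (l x) • l
  null : l k = 0
  ne_zero : l ≠ 0
  differentiable : Differentiable ℝ ψ
  weight_ne_zero : ∀ t, ψ t ≠ 0

theorem fderiv_comp_functional {l : E →L[ℝ] ℝ} {H : ℝ → ℝ} {x : E}
    (hH : DifferentiableAt ℝ H (l x)) : fderiv ℝ (fun y => H (l y)) x = deriv H (l x) • l :=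
  (hH.hasDerivAt.comp_hasFDerivAt x l.hasFDerivAt).fderiv

namespace IsBrinkmann

variable {B : E → E →L[ℝ] E →L[ℝ] ℝ} {l : E →L[ℝ] ℝ} {k : E} {ψ : ℝ → ℝ} {x : E}

theorem comp_invariant (hB : IsBrinkmann B l k ψ) {X : Type*} (H : ℝ → X) (x : E) (s : ℝ) :
    H (l (x + s • k)) = H (l x) := by
  simp [hB.null]

theorem fderiv_apply_left (hB : IsBrinkmann B l k ψ) (hd : DifferentiableAt ℝ B x) (w z : E) :
    fderiv ℝ B x w k z = deriv ψ (l x) * l w * l z := by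
  rw [← fderiv_clm_apply_apply hd]
  simp only [hB.lower, smul_apply, smul_eq_mul]
  rw [fderiv_comp_functional (H := fun t => ψ t * l z) ((hB.differentiable _).mul_const _),
    deriv_mul_const (hB.differentiable _), smul_apply, smul_eq_mul, mul_right_comm]

theorem christoffel_eq_zero (hB : IsBrinkmann B l k ψ) (hd : DifferentiableAt ℝ B x) :
    christoffel B x k = 0 :=
  christoffel_eq_zero_of_fderiv_eq_zero (fderiv_apply_eq_zero_of_invariant hB.invariant x)
    fun w z => by rw [hB.fderiv_apply_left hd, hB.fderiv_apply_left hd, mul_right_comm]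

theorem coordGradient_comp (hB : IsBrinkmann B l k ψ) (hx : (B x).IsInvertible) {H : ℝ → ℝ}
    (hH : DifferentiableAt ℝ H (l x)) :
    coordGradient B (fun y => H (l y)) x = (deriv H (l x) / ψ (l x)) • k := by
  rw [coordGradient, hx.inverse_apply_eq, fderiv_comp_functional hH, map_smul, hB.lower, smul_smul,
    div_mul_cancel₀ _ (hB.weight_ne_zero _)]

theorem fderiv_coordGradient_comp (hB : IsBrinkmann B l k ψ) (hx : (B x).IsInvertible) {K : ℝ → ℝ}
    (hK : DifferentiableAt ℝ K (l x)) (H : ℝ → ℝ) :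
    fderiv ℝ (fun y => H (l y)) x (coordGradient B (fun y => K (l y)) x) = 0 := by
  rw [hB.coordGradient_comp hx hK, map_smul,
    fderiv_apply_eq_zero_of_invariant (hB.comp_invariant H), smul_zero]

theorem coordDivergence_coordGradient_comp [FiniteDimensional ℝ E] (hB : IsBrinkmann B l k ψ)
    (hreg : ∀ y, IsRegularMetricAt B y) (hsymm : ∀ y v w, B y v w = B y w v) {H : ℝ → ℝ}
    (hH : ContDiff ℝ 2 H) (x : E) :
    coordDivergence B (coordGradient B fun y => H (l y)) x = 0 := by
  have hgrad : (coordGradient B fun y => H (l y)) = fun y => (deriv H (l y) / ψ (l y)) • k :=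
    funext fun y => hB.coordGradient_comp (hreg y).isInvertible (hH.differentiable two_ne_zero _)
  have hcoeff : Differentiable ℝ fun y => deriv H (l y) / ψ (l y) :=
    ((hH.differentiable_deriv_two).div hB.differentiable hB.weight_ne_zero).comp l.differentiable
  have hparallel (v : E) : christoffel B x v k = 0 := by
    rw [christoffel_comm (hreg x).differentiableAt hsymm,
      hB.christoffel_eq_zero (hreg x).differentiableAt, zero_apply]
  rw [hgrad, coordDivergence_smul_of_parallel (hcoeff x) hparallel]
  exact fderiv_apply_eq_zero_of_invariant (hB.comp_invariant fun t => deriv H t / ψ t) x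

section WarpedProduct

variable [FiniteDimensional ℝ E] [FiniteDimensional ℝ E'] {K : ℝ → ℝ}
  {γ : E' → E' →L[ℝ] E' →L[ℝ] ℝ} {x : E × E'}

theorem christoffel_warpedCoord_eq_zero (hB : IsBrinkmann B l k ψ) (hreg : IsRegularMetricAt B x.1)
    (hK : ContDiff ℝ 2 K) (hK0 : ∀ t, K t ≠ 0) (hγ : IsRegularMetricAt γ x.2) :
    christoffel (warpedCoord B (fun y => K (l y)) γ) x (k, 0) = 0 :=
  christoffel_warpedCoord_inl_eq_zero hreg (hK.comp l.contDiff).contDiffAt (hK0 _) hγ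
    (hB.christoffel_eq_zero hreg.differentiableAt)
    (fderiv_apply_eq_zero_of_invariant (hB.comp_invariant K) x.1)

theorem coordRicci_warpedCoord_null (hB : IsBrinkmann B l k ψ) (hreg : ∀ y, IsRegularMetricAt B y)
    (hK : ContDiff ℝ 2 K) (hK0 : ∀ t, K t ≠ 0) (hγ : IsRegularMetricAt γ x.2) (z : E × E') :
    coordRicci (warpedCoord B (fun y => K (l y)) γ) x (k, 0) z = 0 := by
  have hwarped : IsRegularMetricAt (warpedCoord B (fun y => K (l y)) γ) x :=
    isRegularMetricAt_warpedCoord (hreg _) (hK.comp l.contDiff).contDiffAt (hK0 _) hγ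
  refine coordRicci_eq_zero_of_parallel (fun y s => ?_) hwarped.differentiableAt_christoffel ?_ z
  · simp [warpedCoord, hB.invariant, hB.null]
  · filter_upwards [continuousAt_snd.eventually hγ.eventually] with y hγ'
      using hB.christoffel_warpedCoord_eq_zero (hreg _) hK hK0 hγ'

theorem coordHessian_warpedCoord_null (hB : IsBrinkmann B l k ψ) (hreg : IsRegularMetricAt B x.1)
    (hK : ContDiff ℝ 2 K) (hK0 : ∀ t, K t ≠ 0) (hγ : IsRegularMetricAt γ x.2) (H : ℝ → ℝ)
    (z : E × E') :
    coordHessian (warpedCoord B (fun y => K (l y)) γ) (fun y => H (l y.1)) x (k, 0) z = 0 :=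
  coordHessian_eq_zero_of_parallel (fun y s => hB.comp_invariant H y.1 s)
    (hB.christoffel_warpedCoord_eq_zero hreg hK hK0 hγ) z

theorem coordRicci_warpedCoord_fiber (hB : IsBrinkmann B l k ψ)
    (hreg : ∀ y, IsRegularMetricAt B y) (hsymm : ∀ y v w, B y v w = B y w v)
    (hK : ContDiff ℝ 2 K) (hK0 : ∀ t, K t ≠ 0) (hγ : IsRegularMetricAt γ x.2) (w z : E') :
    coordRicci (warpedCoord B (fun y => K (l y)) γ) x (0, w) (0, z) = coordRicci γ x.2 w z := by
  rw [SemiRiem.coordRicci_warpedCoord_fiber (κ := fun y => K (l y)) (hreg _)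
      (hK.comp l.contDiff).contDiffAt (hK0 _) hγ,
    hB.coordDivergence_coordGradient_comp hreg hsymm hK,
    hB.fderiv_coordGradient_comp (hreg _).isInvertible (hK.differentiable two_ne_zero _)]
  ring

theorem coordHessian_warpedCoord_fiber (hB : IsBrinkmann B l k ψ) (hreg : IsRegularMetricAt B x.1)
    (hK : ContDiff ℝ 2 K) (hK0 : ∀ t, K t ≠ 0) (hγ : IsRegularMetricAt γ x.2) {H : ℝ → ℝ}
    (hH : DifferentiableAt ℝ H (l x.1)) (w z : E') :
    coordHessian (warpedCoord B (fun y => K (l y)) γ) (fun y => H (l y.1)) x (0, w) (0, z) = 0 := by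
  rw [SemiRiem.coordHessian_warpedCoord_fiber (κ := fun y => K (l y)) (H := fun y => H (l y))
      hreg (hK.comp l.contDiff).contDiffAt (hK0 _) hγ (hH.comp _ l.differentiableAt),
    hB.fderiv_coordGradient_comp hreg.isInvertible (hK.differentiable two_ne_zero _), mul_zero]

end WarpedProduct

end IsBrinkmann

end Brinkmann

section Charts

variable {E : Type*} [NormedAddCommGroup E] [NormedSpace ℝ E]
  {H : Type*} [TopologicalSpace H] {I : ModelWithCorners ℝ E H}
  {M : Type*} [TopologicalSpace M] [ChartedSpace H M]
  {E' : Type*} [NormedAddCommGroup E'] [NormedSpace ℝ E']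
  {H' : Type*} [TopologicalSpace H'] {J : ModelWithCorners ℝ E' H'}
  {F : Type*} [TopologicalSpace F] [ChartedSpace H' F]

namespace SemiRiemannianMetric

theorem isRegularMetricAt_inChart [FiniteDimensional ℝ E] [I.Boundaryless] [IsManifold I 1 M]
    (g : SemiRiemannianMetric I M) (p : M) :
    IsRegularMetricAt (inChart g.toFun p) (extChartAt I p p) where
  contDiffAt := ((g.smooth p).contDiffAt (extChartAt_target_mem_nhds p)).of_le (by norm_cast)
  isInvertible := isInvertible_of_nondegenerate fun v hv => by
    have hA := isInvertible_mfderivWithin_extChartAt_symm (I := I) (mem_extChartAt_target p)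
    rw [I.range_eq_univ, mfderivWithin_univ] at hA
    refine hA.injective (Eq.trans ?_ (map_zero _).symm)
    refine g.nondegenerate _ _ fun w => ?_
    obtain ⟨w', rfl⟩ := hA.surjective w
    exact hv w'

theorem isRegularMetricAt [FiniteDimensional ℝ E] (g : SemiRiemannianMetric 𝓘(ℝ, E) E) (x : E) :
    IsRegularMetricAt g.toFun x := by
  have hchart := g.isRegularMetricAt_inChart x
  rwa [funext (inChart_self g.toFun x)] at hchart

theorem ricci_eq [IsManifold I 1 M] (g : SemiRiemannianMetric I M) (p : M)
    (v w : TangentSpace I p) :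
    g.ricci p v w = coordRicci (inChart g.toFun p) (extChartAt I p p) v w := by
  rw [ricci, mfderiv_extChartAt_self]
  rfl

theorem hessian_eq [IsManifold I 1 M] (g : SemiRiemannianMetric I M) (h : M → ℝ) (p : M)
    (v w : TangentSpace I p) :
    g.hessian h p v w = coordHessian (inChart g.toFun p) (h ∘ (extChartAt I p).symm)
      (extChartAt I p p) v w := by
  rw [hessian, mfderiv_extChartAt_self]
  rfl

theorem eq_zero_of_isEinsteinWith_of_isRicciFlat [Nonempty M] [Nontrivial E]
    {g : SemiRiemannianMetric I M} {μ : ℝ} (hμ : g.IsEinsteinWith μ) (hflat : g.IsRicciFlat) :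
    μ = 0 := by
  obtain ⟨p⟩ := ‹Nonempty M›
  obtain ⟨v, hv⟩ := exists_ne (0 : E)
  by_contra hμ0
  exact hv <| g.nondegenerate p v fun w =>
    (mul_eq_zero.1 ((hμ p v w).symm.trans (hflat p v w))).resolve_left hμ0

/-- The equation `Ric_g + Hess h - θ ∇u ⊗ ∇u = lam g` of a Ricci-harmonic soliton. -/
def SolitonEquation (g : SemiRiemannianMetric I M) (h u : M → ℝ) (θ lam : ℝ) : Prop :=
  ∀ (p : M) (v w : TangentSpace I p),
    g.ricci p v w + g.hessian h p v w - θ * (differential I u p v * differential I u p w) =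
      lam * g.toFun p v w

end SemiRiemannianMetric

theorem differential_comp_fst {u : E → ℝ} {p : E × F} (hu : DifferentiableAt ℝ u p.1)
    (v : TangentSpace (𝓘(ℝ, E).prod J) p) :
    differential (𝓘(ℝ, E).prod J) (fun q => u q.1) p v = fderiv ℝ u p.1 v.1 := by
  have hcomp := mfderiv_comp p hu.mdifferentiableAt (mdifferentiableAt_fst (I := 𝓘(ℝ, E)) (I' := J))
  rw [mfderiv_fst, mfderiv_eq_fderiv] at hcomp
  exact congrArg (· v) hcomp

theorem differential_comp_functional_fst {l : E →L[ℝ] ℝ} {u : ℝ → ℝ} {p : E × F}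
    (hu : DifferentiableAt ℝ u (l p.1)) (v : TangentSpace (𝓘(ℝ, E).prod J) p) :
    differential (𝓘(ℝ, E).prod J) (fun q => u (l q.1)) p v = deriv u (l p.1) * l v.1 :=
  (differential_comp_fst (hu.comp _ l.differentiableAt) v).trans
    (congrArg (· v.1) (fderiv_comp_functional hu))

section WarpedProduct

variable [J.Boundaryless] [IsManifold J ∞ F] (gB : SemiRiemannianMetric 𝓘(ℝ, E) E)
  (gF : SemiRiemannianMetric J F) {f : E → ℝ} (hf : ContMDiff 𝓘(ℝ, E) 𝓘(ℝ, ℝ) ∞ f)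
  (hf0 : ∀ x, 0 < f x) (p : E × F)

theorem inChart_warpedProduct_eventuallyEq :
    inChart (warpedProduct gB gF f hf hf0).toFun p =ᶠ[𝓝 (extChartAt (𝓘(ℝ, E).prod J) p p)]
      warpedCoord gB.toFun (fun x => f x ^ 2) (inChart gF.toFun p.2) := by
  filter_upwards [extChartAt_target_mem_nhds (I := 𝓘(ℝ, E).prod J) p] with x hx
  refine (inChart_warpedField gB.toFun gF.toFun f p x hx).trans ?_
  rw [inChart_self]
  rfl

theorem ricci_warpedProduct (v w : TangentSpace (𝓘(ℝ, E).prod J) p) :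
    (warpedProduct gB gF f hf hf0).ricci p v w =
      coordRicci (warpedCoord gB.toFun (fun x => f x ^ 2) (inChart gF.toFun p.2))
        (p.1, extChartAt J p.2 p.2) v w :=
  (SemiRiemannianMetric.ricci_eq _ p v w).trans <|
    congrFun₂ (coordRicci_congr (inChart_warpedProduct_eventuallyEq gB gF hf hf0 p)) v w

theorem hessian_warpedProduct (h : E → ℝ) (v w : TangentSpace (𝓘(ℝ, E).prod J) p) :
    (warpedProduct gB gF f hf hf0).hessian (fun q => h q.1) p v w =
      coordHessian (warpedCoord gB.toFun (fun x => f x ^ 2) (inChart gF.toFun p.2))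
        (fun y => h y.1) (p.1, extChartAt J p.2 p.2) v w :=
  (SemiRiemannianMetric.hessian_eq _ _ p v w).trans <| congrArg (· v w) <|
    coordHessian_congr (inChart_warpedProduct_eventuallyEq gB gF hf hf0 p) fun y => h y.1

end WarpedProduct

theorem contDiff_of_contMDiff_comp_fst [Nonempty F] {l : E →L[ℝ] ℝ} (hl : l ≠ 0) {H : ℝ → ℝ}
    (hH : ContMDiff (𝓘(ℝ, E).prod J) 𝓘(ℝ, ℝ) ∞ fun p : E × F => H (l p.1)) : ContDiff ℝ ∞ H := by
  obtain ⟨q⟩ := ‹Nonempty F›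
  obtain ⟨e, he⟩ := DFunLike.ne_iff.1 hl
  have hline : ContMDiff 𝓘(ℝ, ℝ) (𝓘(ℝ, E).prod J) ∞ fun t : ℝ => ((t / l e) • e, q) :=
    ((contDiff_id.div_const (l e)).smul contDiff_const).contMDiff.prodMk contMDiff_const
  have hcomp : H = (fun p : E × F => H (l p.1)) ∘ fun t => ((t / l e) • e, q) :=
    funext fun t => by simp [div_mul_cancel₀ t he]
  exact hcomp ▸ (hH.comp hline).contDiff

end Charts

section NullWarping

variable {E : Type*} [NormedAddCommGroup E] [NormedSpace ℝ E]
  {E' : Type*} [NormedAddCommGroup E'] [NormedSpace ℝ E']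
  {H' : Type*} [TopologicalSpace H'] {J : ModelWithCorners ℝ E' H'} [J.Boundaryless]
  {F : Type*} [TopologicalSpace F] [ChartedSpace H' F] [IsManifold J ∞ F]
  {gB : SemiRiemannianMetric 𝓘(ℝ, E) E} {gF : SemiRiemannianMetric J F}
  {l : E →L[ℝ] ℝ} {k : E} {ψ : ℝ → ℝ}

/-- The warped product of a vector space with warping function `f(l)`, for a linear function `l`. -/
abbrev warpedProductAlong (gB : SemiRiemannianMetric 𝓘(ℝ, E) E) (gF : SemiRiemannianMetric J F)
    (l : E →L[ℝ] ℝ) {f : ℝ → ℝ} (hf : ContDiff ℝ ∞ f) (hf0 : ∀ t, 0 < f t) :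
    SemiRiemannianMetric (𝓘(ℝ, E).prod J) (E × F) :=
  warpedProduct gB gF (fun x => f (l x)) (hf.comp l.contDiff).contMDiff fun x => hf0 (l x)

namespace IsBrinkmann

variable (hB : IsBrinkmann gB.toFun l k ψ) {f : ℝ → ℝ} (hf : ContDiff ℝ ∞ f) (hf0 : ∀ t, 0 < f t)
  (p : E × F)

include hB

theorem warpedProductAlong_null (z : TangentSpace (𝓘(ℝ, E).prod J) p) :
    (warpedProductAlong gB gF l hf hf0).toFun p (k, (0 : E')) z = ψ (l p.1) * l z.1 := by
  have hbase : gB.toFun p.1 k z.1 = ψ (l p.1) * l z.1 := congrArg (· z.1) (hB.lower p.1)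
  have hfiber : gF.toFun p.2 (0 : TangentSpace J p.2) z.2 = 0 :=
    congrArg (· z.2) (map_zero (gF.toFun p.2))
  refine (warpedField_apply _ _ _ p _ z).trans ?_
  calc gB.toFun p.1 k z.1 + f (l p.1) ^ 2 * gF.toFun p.2 (0 : TangentSpace J p.2) z.2
      = ψ (l p.1) * l z.1 + f (l p.1) ^ 2 * 0 := congrArg₂ (· + f (l p.1) ^ 2 * ·) hbase hfiber
    _ = ψ (l p.1) * l z.1 := by ring

variable [FiniteDimensional ℝ E] [FiniteDimensional ℝ E']

theorem ricci_warpedProductAlong_null (z : TangentSpace (𝓘(ℝ, E).prod J) p) :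
    (warpedProductAlong gB gF l hf hf0).ricci p (k, (0 : E')) z = 0 :=
  have : IsManifold J 1 F := .of_le (n := ∞) (by simp)
  (ricci_warpedProduct gB gF _ _ p _ z).trans <|
    hB.coordRicci_warpedCoord_null gB.isRegularMetricAt ((hf.pow 2).of_le (by norm_cast))
      (fun t => (pow_pos (hf0 t) 2).ne') (gF.isRegularMetricAt_inChart p.2) z

theorem hessian_warpedProductAlong_null (h : ℝ → ℝ) (z : TangentSpace (𝓘(ℝ, E).prod J) p) :
    (warpedProductAlong gB gF l hf hf0).hessian (fun q => h (l q.1)) p (k, (0 : E')) z = 0 :=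
  have : IsManifold J 1 F := .of_le (n := ∞) (by simp)
  (hessian_warpedProduct gB gF _ _ p (fun x => h (l x)) _ z).trans <|
    hB.coordHessian_warpedCoord_null (gB.isRegularMetricAt _) ((hf.pow 2).of_le (by norm_cast))
      (fun t => (pow_pos (hf0 t) 2).ne') (gF.isRegularMetricAt_inChart p.2) h z

theorem ricci_warpedProductAlong_fiber (w z : E') :
    (warpedProductAlong gB gF l hf hf0).ricci p ((0 : E), w) ((0 : E), z) = gF.ricci p.2 w z :=
  have : IsManifold J 1 F := .of_le (n := ∞) (by simp)
  (ricci_warpedProduct gB gF _ _ p _ _).trans <|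
    (hB.coordRicci_warpedCoord_fiber gB.isRegularMetricAt gB.symm ((hf.pow 2).of_le (by norm_cast))
      (fun t => (pow_pos (hf0 t) 2).ne') (gF.isRegularMetricAt_inChart p.2) w z).trans
    (gF.ricci_eq p.2 w z).symm

theorem hessian_warpedProductAlong_fiber {h : ℝ → ℝ} (hh : Differentiable ℝ h) (w z : E') :
    (warpedProductAlong gB gF l hf hf0).hessian (fun q => h (l q.1)) p
      ((0 : E), w) ((0 : E), z) = 0 :=
  have : IsManifold J 1 F := .of_le (n := ∞) (by simp)
  (hessian_warpedProduct gB gF _ _ p (fun x => h (l x)) _ _).trans <|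
    hB.coordHessian_warpedCoord_fiber (gB.isRegularMetricAt _) ((hf.pow 2).of_le (by norm_cast))
      (fun t => (pow_pos (hf0 t) 2).ne') (gF.isRegularMetricAt_inChart p.2) (hh _) w z

end IsBrinkmann

end NullWarping

section SemiEuclidean

variable {n : ℕ} {α : EuclideanSpace ℝ (Fin n)} {ε : Fin n → ℤˣ}

/-- `ξ` as a continuous linear functional. -/
def xiCLM (α : EuclideanSpace ℝ (Fin n)) : EuclideanSpace ℝ (Fin n) →L[ℝ] ℝ where
  toFun := xi α
  map_add' v w := by simp [xi, mul_add, Finset.sum_add_distrib]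
  map_smul' c v := by simp [xi, Finset.mul_sum, mul_left_comm]
  cont := (contDiff_xi α).continuous

theorem xiCLM_ne_zero (hα : α ≠ 0) : xiCLM α ≠ 0 := by
  refine DFunLike.ne_iff.2 ⟨α, ?_⟩
  have hself : xi α α = ‖α‖ ^ 2 := by
    rw [EuclideanSpace.real_norm_sq_eq]
    exact Finset.sum_congr rfl fun i _ => (sq _).symm
  change xi α α ≠ 0
  rw [hself]
  exact pow_ne_zero 2 (norm_ne_zero_iff.2 hα)

/-- The `g₀`-gradient of `ξ`, with components `εᵢ αᵢ`. -/
def xiGrad (ε : Fin n → ℤˣ) (α : EuclideanSpace ℝ (Fin n)) : EuclideanSpace ℝ (Fin n) :=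
  WithLp.toLp 2 fun i => ((ε i : ℤ) : ℝ) * α i

theorem semiEuclidean_xiGrad (ε : Fin n → ℤˣ) (α : EuclideanSpace ℝ (Fin n)) :
    semiEuclidean ε (xiGrad ε α) = xiCLM α := by
  refine ContinuousLinearMap.ext fun v => (semiEuclidean_apply _ _ _).trans ?_
  refine Finset.sum_congr rfl fun i _ => ?_
  have hε : ((ε i : ℤ) : ℝ) * ((ε i : ℤ) : ℝ) = 1 := mod_cast Int.units_coe_mul_self (ε i)
  simp only [xiGrad]
  linear_combination α i * v i * hε

theorem xiCLM_xiGrad (ε : Fin n → ℤˣ) (α : EuclideanSpace ℝ (Fin n)) :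
    xiCLM α (xiGrad ε α) = ∑ i, ((ε i : ℤ) : ℝ) * α i ^ 2 := by
  change ∑ i, α i * (((ε i : ℤ) : ℝ) * α i) = _
  exact Finset.sum_congr rfl fun i _ => by ring

theorem isBrinkmann_conformalMetric (hα : α ≠ 0) (hnull : ∑ i, ((ε i : ℤ) : ℝ) * α i ^ 2 = 0)
    {φ : ℝ → ℝ} (hφ : ContDiff ℝ ∞ φ) (hφ0 : ∀ t, φ t ≠ 0) :
    IsBrinkmann (conformalMetric ε (fun x => φ (xi α x)) (hφ.comp (contDiff_xi α))
      fun x => hφ0 (xi α x)).toFun (xiCLM α) (xiGrad ε α) fun t => (φ t ^ 2)⁻¹ := by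
  have hxi : xiCLM α (xiGrad ε α) = 0 := (xiCLM_xiGrad ε α).trans hnull
  refine ⟨fun x s => ?_, fun x => ?_, hxi, xiCLM_ne_zero hα, ?_, fun t => ?_⟩
  · have hinv : xiCLM α (x + s • xiGrad ε α) = xiCLM α x := by simp [hxi]
    exact congrArg (fun t => (φ t ^ 2)⁻¹ • semiEuclidean ε) hinv
  · exact congrArg ((φ (xi α x) ^ 2)⁻¹ • ·) (semiEuclidean_xiGrad ε α)
  · exact ((hφ.differentiable (by simp)).pow 2).inv fun t => pow_ne_zero 2 (hφ0 t)
  · exact inv_ne_zero (pow_ne_zero 2 (hφ0 t))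

end SemiEuclidean

end SemiRiem

end

theorem mainTheorem5_general {E : Type*} [NormedAddCommGroup E] [NormedSpace ℝ E]
    [FiniteDimensional ℝ E] {E' : Type*} [NormedAddCommGroup E'] [NormedSpace ℝ E']
    [FiniteDimensional ℝ E'] {H' : Type*} [TopologicalSpace H'] {J : ModelWithCorners ℝ E' H'}
    [J.Boundaryless] {F : Type*} [TopologicalSpace F] [ChartedSpace H' F] [IsManifold J ∞ F]
    [Nonempty F] {gB : SemiRiemannianMetric 𝓘(ℝ, E) E} {gF : SemiRiemannianMetric J F}
    {l : E →L[ℝ] ℝ} {k : E} {ψ : ℝ → ℝ} (hB : IsBrinkmann gB.toFun l k ψ)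
    {f h u : ℝ → ℝ} (hf : ContDiff ℝ ∞ f) (hf0 : ∀ t, 0 < f t) (hh : Differentiable ℝ h)
    (hu : Differentiable ℝ u) {θ lam : ℝ}
    (hG : (warpedProductAlong gB gF l hf hf0).SolitonEquation
      (fun p => h (l p.1)) (fun p => u (l p.1)) θ lam) :
    lam = 0 ∧ gF.IsRicciFlat := by
  have hlam : lam = 0 := by
    obtain ⟨q⟩ := ‹Nonempty F›
    obtain ⟨e, he⟩ := DFunLike.ne_iff.1 hB.ne_zero
    have hnull := hG (0, q) (k, (0 : E')) (e, (0 : E'))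
    rw [hB.ricci_warpedProductAlong_null hf hf0 (0, q) (e, (0 : E')),
      hB.hessian_warpedProductAlong_null hf hf0 (0, q) h (e, (0 : E')),
      hB.warpedProductAlong_null hf hf0 (0, q) (e, (0 : E')),
      differential_comp_functional_fst (hu _) (k, (0 : E'))] at hnull
    simpa [hB.null, hB.weight_ne_zero, show l e ≠ 0 from he] using hnull
  refine ⟨hlam, fun q (w z : E') => ?_⟩
  have hfiber := hG (0, q) ((0 : E), w) ((0 : E), z)
  rw [hB.ricci_warpedProductAlong_fiber hf hf0 (0, q) w z,
    hB.hessian_warpedProductAlong_fiber hf hf0 (0, q) hh w z,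
    differential_comp_functional_fst (hu _) ((0 : E), w), hlam] at hfiber
  simpa using hfiber

theorem mainTheorem5 {n m : ℕ} (hm : 0 < m)
    {F : Type*} [TopologicalSpace F] [ChartedSpace (EuclideanSpace ℝ (Fin m)) F]
    [IsManifold (𝓡 m) ∞ F] [Nonempty F]
    (gF : SemiRiemannianMetric (𝓡 m) F)
    (ε : Fin n → ℤˣ) (α : EuclideanSpace ℝ (Fin n)) (hα : α ≠ 0)
    (φ f h u : ℝ → ℝ)
    (hφ : ContDiff ℝ ∞ φ) (hφ0 : ∀ t, φ t ≠ 0)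
    (hf : ContDiff ℝ ∞ f) (hf0 : ∀ t, 0 < f t)
    (hu : ¬ ∃ c, ∀ t, u t = c)
    (lam : ℝ)
    (hG : (warpedProduct
        (conformalMetric ε (fun x => φ (xi α x)) (hφ.comp (contDiff_xi α)) (fun x => hφ0 (xi α x)))
        gF (fun x => f (xi α x)) (hf.comp (contDiff_xi α)).contMDiff
        (fun x => hf0 (xi α x))).IsGRHS
      (fun p => h (xi α p.1)) (fun p => u (xi α p.1)) lam)
    (hnull : ∑ i, ((ε i : ℤ) : ℝ) * α i ^ 2 = 0) :
    lam = 0 ∧ gF.IsRicciFlat ∧ ∀ μ : ℝ, gF.IsEinsteinWith μ → μ = 0 := by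
  have hB := isBrinkmann_conformalMetric hα hnull hφ hφ0
  have hl := xiCLM_ne_zero hα
  obtain ⟨θ, -, hsoliton⟩ := hG.soliton
  obtain ⟨hlam, hflat⟩ := mainTheorem5_general hB hf hf0
    ((contDiff_of_contMDiff_comp_fst hl hG.smooth_potential).differentiable (by simp))
    ((contDiff_of_contMDiff_comp_fst hl hG.smooth_map).differentiable (by simp)) hsoliton
  have : NeZero m := ⟨hm.ne'⟩
  exact ⟨hlam, hflat, fun μ hμ =>
    SemiRiemannianMetric.eq_zero_of_isEinsteinWith_of_isRicciFlat hμ hflat⟩
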